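/- Let $\Bbbk$ be an algebraically closed field and let $\mathscr C$ be a locally-finite pivotal $\Bbbk$-tensor category with enough projectives. This means: $\mathscr C$ is an abelian $\Bbbk$-linear monoidal category with $\Bbbk$-bilinear tensor product, all Hom-spaces are finite-dimensional, $\operatorname{End}(\mathbb 1)=\Bbbk$, every object has a projective cover, and $\mathscr C$ is pivotal, i.e. every object $V$ has a chosen object $V^*$ with morphisms $\overleftarrow{\mathrm{coev}}_V:\mathbb 1\to V\otimes V^*$, $\overleftarrow{\mathrm{ev}}_V:V^*\otimes V\to\mathbb 1$ making it a left dual and $\overrightarrow{\mathrm{coev}}_V:\mathbb 1\to V^*\otimes V$, $\overrightarrow{\mathrm{ev}}_V:V\otimes V^*\to\mathbb 1$ making it a right dual, such that both dualities induce the same transposes of morphisms and the same isomorphisms $W^*\otimes V^*\to(V\otimes W)^*$. Let $\operatorname{Proj}(\mathscr C)$ be the full subcategory of projective objects, and for an object $X$ let $F_X=X\otimes-$, an endofunctor of $\operatorname{Proj}(\mathscr C)$. For $g: V\otimes W\to X\otimes W$ let $\operatorname{tr}^W_r(g)=(\mathrm{id}_X\otimes\overrightarrow{\mathrm{ev}}_W)(g\otimes\mathrm{id}_{W^*})(\mathrm{id}_V\otimes\overleftarrow{\mathrm{coev}}_W):V\to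 X$ be the right partial trace. A trace tuple $(P,\alpha,\beta,\eta,\epsilon)$ consists of objects $P,\alpha,\beta$ and nonzero morphisms $\eta:\alpha\to P$, $\epsilon:P\to\beta$ such that $\operatorname{End}(P)/J(\operatorname{End}(P))\cong\Bbbk$ with $J(\operatorname{End}(P))$ (the Jacobson radical) nilpotent, and $\operatorname{Hom}(\alpha,P)$ and $\operatorname{Hom}(P,\beta)$ are free over $\Bbbk$ on $\eta$ and $\epsilon$ respectively. A right $(\alpha,\beta)$-trace on $\operatorname{Proj}(\mathscr C)$ is a family of linear forms $t_V:\operatorname{Hom}(\alpha\otimes V,\beta\otimes V)\to\Bbbk$, $V$ projective, with $t_{U\otimes W}(f)=t_U(\operatorname{tr}_r^W(f))$ for $U$ projective and $W$ arbitrary, and $t_V((\mathrm{id}_\beta\otimes g)f)=t_U(f(\mathrm{id}_\alpha\otimes g))$ for $U,V$ projective, $f:\alpha\otimes V\to\beta\otimes U$ and $g:U\to V$. A $\Bbbk$-linear category $\mathscr D$ with endofunctors $F,G$ is made $(F,G)$-twisted Calabi–Yau by a family of linear forms $t_U:\operatorname{Hom}(F(U),G(U))\to\Bbbk$ if for all objects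 $U,V$ the pairing $\operatorname{Hom}(V,G(U))\times\operatorname{Hom}(F(U),V)\to\Bbbk$, $(g,f)\mapsto t_U(gf)$, is non-degenerate, and $t_V(G(g)f)=t_U(fF(g))$ for all $f:F(V)\to G(U)$ and $g:U\to V$. Theorem. Let $P$ be an indecomposable projective object of $\mathscr C$. There is a trace tuple $(P,\alpha,\beta,\eta,\epsilon)$ with $\alpha$ and $\beta$ simple. For every such trace tuple, and every projective $V$, the morphism $\eta\otimes\mathrm{id}_V$ is a split monomorphism and $\epsilon\otimes\mathrm{id}_V$ is a split epimorphism; there is a unique right $(\alpha,\beta)$-trace $t$ on $\operatorname{Proj}(\mathscr C)$ such that $\operatorname{tr}_r^V(\tau f)=t_V(f)\,\eta$ and $\operatorname{tr}_r^V(f\sigma)=t_V(f)\,\epsilon$ for all projective $V$, all $f:\alpha\otimes V\to\beta\otimes V$, all sections $\tau$ of $\epsilon\otimes\mathrm{id}_V$ and all retractions $\sigma$ of $\eta\otimes\mathrm{id}_V$; and this $t$ makes $\operatorname{Proj}(\mathscr C)$ an $(F_\alpha,F_\beta)$-twisted Calabi–Yau category. In particular $\operatorname{Proj}(\mathscr C)$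 admits a right Serre functor: there is a trace tuple $(P,\mathbb 1,\beta,\eta,\epsilon)$ with $P$ indecomposable projective and $\beta$ simple such that $S=F_\beta$ has linear isomorphisms $\operatorname{Hom}(U,V)\cong\operatorname{Hom}(V,S(U))^*$, natural in the projective objects $U$ and $V$. -/

import Mathlib

open CategoryTheory MonoidalCategory

universe w v u

namespace PivotalTrace

section Pivotal

/-- Every object `V` has a chosen object `dual V`, which is at the same time a left and a right dual
of `V`; no compatibility between the two dualities is required yet. -/
class TwoSidedDuality (C : Type u) [Category.{v} C] [MonoidalCategory C] where
  /-- the object `V*` -/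
  dual : C → C
  /-- left duality: `𝟙 ⟶ V ⊗ V*` and `V* ⊗ V ⟶ 𝟙`, with the two zigzag identities -/
  leftDuality (V : C) : ExactPairing V (dual V)
  /-- right duality: `𝟙 ⟶ V* ⊗ V` and `V ⊗ V* ⟶ 𝟙`, with the two zigzag identities -/
  rightDuality (V : C) : ExactPairing (dual V) V

variable {C : Type u} [Category.{v} C] [MonoidalCategory C] [TwoSidedDuality C]

/-- The object `V*`. -/
abbrev dual (V : C) : C := TwoSidedDuality.dual V

/-- `coev← : 𝟙 ⟶ V ⊗ V*`. -/
def coevL (V : C) : 𝟙_ C ⟶ V ⊗ dual V :=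
  @ExactPairing.coevaluation C _ _ V (dual V) (TwoSidedDuality.leftDuality V)

/-- `ev← : V* ⊗ V ⟶ 𝟙`. -/
def evL (V : C) : dual V ⊗ V ⟶ 𝟙_ C :=
  @ExactPairing.evaluation C _ _ V (dual V) (TwoSidedDuality.leftDuality V)

/-- `coev→ : 𝟙 ⟶ V* ⊗ V`. -/
def coevR (V : C) : 𝟙_ C ⟶ dual V ⊗ V :=
  @ExactPairing.coevaluation C _ _ (dual V) V (TwoSidedDuality.rightDuality V)

/-- `ev→ : V ⊗ V* ⟶ 𝟙`. -/
def evR (V : C) : V ⊗ dual V ⟶ 𝟙_ C :=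
  @ExactPairing.evaluation C _ _ (dual V) V (TwoSidedDuality.rightDuality V)

/-- The transpose `f* : W* ⟶ V*` of `f : V ⟶ W` for the left duality. -/
def transposeL {V W : C} (f : V ⟶ W) : dual W ⟶ dual V :=
  (ρ_ (dual W)).inv ≫ dual W ◁ coevL V ≫ dual W ◁ f ▷ dual V ≫
    (α_ (dual W) W (dual V)).inv ≫ evL W ▷ dual V ≫ (λ_ (dual V)).hom

/-- The transpose of `f : V ⟶ W` for the right duality. -/
def transposeR {V W : C} (f : V ⟶ W) : dual W ⟶ dual V :=
  (λ_ (dual W)).inv ≫ coevR V ▷ dual W ≫ (dual V ◁ f) ▷ dual W ≫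
    (α_ (dual V) W (dual W)).hom ≫ dual V ◁ evR W ≫ (ρ_ (dual V)).hom

/-- The comparison `γ : W* ⊗ V* ⟶ (V ⊗ W)*` for the left duality. -/
def gammaL (V W : C) : dual W ⊗ dual V ⟶ dual (V ⊗ W) :=
  𝟙 (dual W ⊗ dual V) ⊗≫ (dual W ⊗ dual V) ◁ coevL (V ⊗ W) ⊗≫
    dual W ◁ evL V ▷ (W ⊗ dual (V ⊗ W)) ⊗≫ evL W ▷ dual (V ⊗ W) ⊗≫ 𝟙 (dual (V ⊗ W))

/-- The comparison `W* ⊗ V* ⟶ (V ⊗ W)*` for the right duality. -/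
def gammaR (V W : C) : dual W ⊗ dual V ⟶ dual (V ⊗ W) :=
  𝟙 (dual W ⊗ dual V) ⊗≫ coevR (V ⊗ W) ▷ (dual W ⊗ dual V) ⊗≫
    (dual (V ⊗ W) ⊗ V) ◁ evR W ▷ dual V ⊗≫ dual (V ⊗ W) ◁ evR V ⊗≫ 𝟙 (dual (V ⊗ W))

/-- A pivotal category: left and right duality give the same duals, the same transposes and the same
comparison isomorphisms. -/
class PivotalCategory (C : Type u) [Category.{v} C] [MonoidalCategory C] extends
    TwoSidedDuality C where
  transpose_eq {V W : C} (f : V ⟶ W) : transposeL f = transposeR f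
  gamma_eq (V W : C) : gammaL V W = gammaR V W

/-- The right partial trace with respect to `W`. -/
def rightPartialTrace {V X : C} (W : C) (g : V ⊗ W ⟶ X ⊗ W) : V ⟶ X :=
  (ρ_ V).inv ≫ V ◁ coevL W ≫ (α_ V W (dual W)).inv ≫ g ▷ dual W ≫
    (α_ X W (dual W)).hom ≫ X ◁ evR W ≫ (ρ_ X).hom

/-- A right ideal: a full subcategory closed under `- ⊗ W` for all `W`, and under retracts. -/
structure IsRightIdeal (I : ObjectProperty C) : Prop where
  tensor {V : C} (hV : I V) (W : C) : I (V ⊗ W)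
  retract {V W : C} (hV : I V) (f : W ⟶ V) (g : V ⟶ W) (hfg : f ≫ g = 𝟙 W) : I W

lemma projective_tensor_left (X : C) {Q : C} (hQ : Projective Q) : Projective (X ⊗ Q) := by
  have := TwoSidedDuality.leftDuality X
  have := TwoSidedDuality.rightDuality X
  have : (tensorLeft (dual X)).PreservesEpimorphisms :=
    Functor.preservesEpimorphisms_of_adjunction (tensorLeftAdjunction X (dual X))
  exact (tensorLeftAdjunction (dual X) X).map_projective Q hQ

lemma isRightIdeal_projective : IsRightIdeal (isProjective C) where
  tensor {V} hV W := by
    have := TwoSidedDuality.leftDuality W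
    have := TwoSidedDuality.rightDuality W
    have : (tensorRight (dual W)).PreservesEpimorphisms :=
      Functor.preservesEpimorphisms_of_adjunction (tensorRightAdjunction (dual W) W)
    exact (tensorRightAdjunction W (dual W)).map_projective V hV
  retract {V W} hV f g hfg := by
    have : Projective V := hV
    refine ⟨fun {E X} p e he => ⟨f ≫ Projective.factorThru (g ≫ p) e, ?_⟩⟩
    rw [Category.assoc, Projective.factorThru_comp, ← Category.assoc, hfg, Category.id_comp]

/-- The endofunctor `F_X = X ⊗ -` of the full subcategory of projective objects. -/
def tensorProj (X : C) : (isProjective C).FullSubcategory ⥤ (isProjective C).FullSubcategory :=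
  (isProjective C).lift ((isProjective C).ι ⋙ tensorLeft X)
    (fun Q => projective_tensor_left X Q.property)

end Pivotal

section Linear

variable (k : Type w) [Field k]

/-- `X` is absolutely irreducible: `c ↦ c • 𝟙 X` is a bijection from `k` onto `End X`. -/
def AbsolutelyIrreducible {C : Type u} [Category.{v} C] [Preadditive C] [Linear k C] (X : C) :
    Prop :=
  Function.Bijective (fun c : k => c • 𝟙 X)

/-- All Hom-spaces have finite length over the field `k`, that is, finite dimension. -/
def LocallyFinite (C : Type u) [Category.{v} C] [Preadditive C] [Linear k C] : Prop :=
  ∀ X Y : C, FiniteDimensional k (X ⟶ Y)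

/-- `p : P ⟶ X` is a projective cover: `P` is projective and `p` is an essential epimorphism. -/
structure IsProjectiveCover {C : Type u} [Category.{v} C] {P X : C} (p : P ⟶ X) : Prop where
  projective : Projective P
  epi : Epi p
  essential {Y : C} (f : Y ⟶ P) (hf : Epi (f ≫ p)) : Epi f

/-- Every object has a projective cover. -/
def HasProjectiveCovers (C : Type u) [Category.{v} C] : Prop :=
  ∀ X : C, ∃ (P : C) (p : P ⟶ X), IsProjectiveCover p

/-- `(P, a, b, η, ε)` is a trace tuple. -/
structure IsTraceTuple {C : Type u} [Category.{v} C] [Preadditive C] [Linear k C] {P a b : C}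
    (η : a ⟶ P) (ε : P ⟶ b) : Prop where
  eta_ne_zero : η ≠ 0
  eps_ne_zero : ε ≠ 0
  /-- `P` is absolutely indecomposable -/
  absolutely_indecomposable :
    Nonempty ((End P ⧸ Ring.jacobson (End P)) ≃ₐ[k] k)
  /-- `P` is end-nilpotent -/
  end_nilpotent : IsNilpotent (Ring.jacobson (End P))
  /-- `Hom(a, P)` is free on `η` -/
  eta_generates (g : a ⟶ P) : ∃! c : k, g = c • η
  /-- `Hom(P, b)` is free on `ε` -/
  eps_generates (h : P ⟶ b) : ∃! c : k, h = c • ε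

/-- The class of objects `V` such that `η ⊗ V` is a split monomorphism and `ε ⊗ V` is a split
epimorphism. -/
def traceIdeal {C : Type u} [Category.{v} C] [MonoidalCategory C] {P a b : C}
    (η : a ⟶ P) (ε : P ⟶ b) : ObjectProperty C := fun V =>
  (∃ s : P ⊗ V ⟶ a ⊗ V, η ▷ V ≫ s = 𝟙 (a ⊗ V)) ∧
    (∃ t : b ⊗ V ⟶ P ⊗ V, t ≫ ε ▷ V = 𝟙 (b ⊗ V))

/-- Right `(a, b)`-traces on a right ideal `I`. -/
structure RightTrace {C : Type u} [Category.{v} C] [Preadditive C] [Linear k C]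
    [MonoidalCategory C] [TwoSidedDuality C] {I : ObjectProperty C} (hI : IsRightIdeal I)
    (a b : C) where
  /-- the linear form `t_V` on `Hom(a ⊗ V, b ⊗ V)`, for `V` in `I` -/
  tr (V : C) (hV : I V) : (a ⊗ V ⟶ b ⊗ V) →ₗ[k] k
  partial_trace (U W : C) (hU : I U) (f : a ⊗ (U ⊗ W) ⟶ b ⊗ (U ⊗ W)) :
    tr (U ⊗ W) (hI.tensor hU W) f =
      tr U hU (rightPartialTrace W ((α_ a U W).hom ≫ f ≫ (α_ b U W).inv))
  cyclic (U V : C) (hU : I U) (hV : I V) (f : a ⊗ V ⟶ b ⊗ U) (g : U ⟶ V) :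
    tr V hV (f ≫ b ◁ g) = tr U hU (a ◁ g ≫ f)

/-- The right `(a, b)`-trace `t` on the projective objects is the one associated to the trace tuple
`(P, a, b, η, ε)`: for every `V`, `f`, every section `τ` of `ε ⊗ V` and every retraction `σ` of
`η ⊗ V`, the partial trace of `τ f` is `t_V(f) η`, and the partial trace of `f σ` is `t_V(f) ε`. -/
structure IsAssociatedTrace {C : Type u} [Category.{v} C] [Preadditive C] [Linear k C]
    [MonoidalCategory C] [TwoSidedDuality C] {P a b : C} (η : a ⟶ P) (ε : P ⟶ b)
    (t : RightTrace k (isRightIdeal_projective (C := C)) a b) : Prop where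
  eq_eta (V : C) (hV : isProjective C V) (f : a ⊗ V ⟶ b ⊗ V) (τ : b ⊗ V ⟶ P ⊗ V)
    (hτ : τ ≫ ε ▷ V = 𝟙 (b ⊗ V)) : rightPartialTrace V (f ≫ τ) = t.tr V hV f • η
  eq_eps (V : C) (hV : isProjective C V) (f : a ⊗ V ⟶ b ⊗ V) (σ : P ⊗ V ⟶ a ⊗ V)
    (hσ : η ▷ V ≫ σ = 𝟙 (a ⊗ V)) : rightPartialTrace V (σ ≫ f) = t.tr V hV f • ε

/-- The family of linear forms on `Hom(F_a U, F_b U)`, for `U` in the category of projective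
objects, given by a right `(a, b)`-trace on the projective objects. -/
def RightTrace.onProj {k : Type w} [Field k] {C : Type u} [Category.{v} C] [Preadditive C]
    [Linear k C] [MonoidalCategory C] [TwoSidedDuality C] {a b : C}
    (t : RightTrace k (isRightIdeal_projective (C := C)) a b)
    (U : (isProjective C).FullSubcategory) :
    ((tensorProj a).obj U ⟶ (tensorProj b).obj U) →ₗ[k] k where
  toFun f := t.tr U.obj U.property f.hom
  map_add' f g := (t.tr U.obj U.property).map_add f.hom g.hom
  map_smul' c f := (t.tr U.obj U.property).map_smul c f.hom

/-- The family `t` makes the `k`-linear category `D` an `(F, G)`-twisted Calabi-Yau category. -/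
structure IsTwistedCalabiYau {D : Type u} [Category.{v} D] [Preadditive D] [Linear k D]
    (F G : D ⥤ D) (t : ∀ U : D, (F.obj U ⟶ G.obj U) →ₗ[k] k) : Prop where
  nondegenerate_left (U V : D) (g : V ⟶ G.obj U) (hg : ∀ f : F.obj U ⟶ V, t U (f ≫ g) = 0) : g = 0
  nondegenerate_right (U V : D) (f : F.obj U ⟶ V) (hf : ∀ g : V ⟶ G.obj U, t U (f ≫ g) = 0) : f = 0
  cyclic (U V : D) (f : F.obj V ⟶ G.obj U) (g : U ⟶ V) :
    t V (f ≫ G.map g) = t U (F.map g ≫ f)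

/-- `S` is a right Serre functor on the `k`-linear category `D`: there are linear isomorphisms
`Hom(U, V) ≃ Hom(V, S U)*`, natural in `U` and in `V`. -/
def IsRightSerreFunctor {D : Type u} [Category.{v} D] [Preadditive D] [Linear k D]
    (S : D ⥤ D) : Prop :=
  ∃ φ : ∀ U V : D, (U ⟶ V) ≃ₗ[k] Module.Dual k (V ⟶ S.obj U),
    (∀ (U V V' : D) (f : U ⟶ V) (h : V ⟶ V') (g : V' ⟶ S.obj U),
      φ U V' (f ≫ h) g = φ U V f (h ≫ g)) ∧
    (∀ (U U' V : D) (u : U' ⟶ U) (f : U ⟶ V) (g : V ⟶ S.obj U'),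
      φ U' V (u ≫ f) g = φ U V f (g ≫ S.map u))

end Linear

end PivotalTrace

/-! An endomorphism of `P` is a scalar plus a radical element; the radical is nilpotent and the
eigenvectors `η`, `ε` are killed by nilpotents, so the endomorphism acts on both by the same scalar
(`IsTraceTuple.exists_scalar`). Applied to the partial trace of `σ ≫ f ≫ τ`, this shows that the
partial traces of `f ≫ τ` and `σ ≫ f` are the same multiple of `η` and of `ε`. That multiple is
`t_V(f)`, independent of both choices. The trace axioms are inherited from the partial trace, where
pivotality enters (`rightPartialTrace_cyclic`, `rightPartialTrace_tensor`).

For nondegeneracy, a nonzero `g : V ⟶ b ⊗ U` has a nonzero mate into the simple `b`, an epimorphism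
through which `ε` lifts. So `ε` is the partial trace of some `s ≫ g`, which forces a nonzero value
of the trace. The other side is dual, because projectives are injective (`injective_of_projective`).
Over finite-dimensional Hom-spaces the pairing is perfect, and for `a = 𝟙` this is Serre duality.

Objects need not be assumed of finite length: with `Q` covering `𝟙`, the dimension of `Hom(Q ⊗ P,
-)` serves as a length on subquotients of `P` and yields a simple subobject and a simple quotient.
They form a trace tuple by `isTraceTuple_of_simple`. For the Serre functor, `𝟙` is simple
(`simple_unit`) and its coevaluation into `Q ⊗ Q*` gives a nonzero map to an indecomposable
projective. -/

namespace PivotalTrace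

/-! ### Mates, transposes and partial traces -/

section Duality

variable {C : Type u} [Category.{v} C] [MonoidalCategory C] [TwoSidedDuality C]

lemma coevL_evL (V : C) : coevL V ▷ V ⊗≫ V ◁ evL V = ⊗𝟙.hom :=
  @ExactPairing.evaluation_coevaluation'' C _ _ V (dual V) (TwoSidedDuality.leftDuality V)

lemma evL_coevL (V : C) : dual V ◁ coevL V ⊗≫ evL V ▷ dual V = ⊗𝟙.hom :=
  @ExactPairing.coevaluation_evaluation'' C _ _ V (dual V) (TwoSidedDuality.leftDuality V)

lemma evR_coevR (V : C) : V ◁ coevR V ⊗≫ evR V ▷ V = ⊗𝟙.hom :=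
  @ExactPairing.coevaluation_evaluation'' C _ _ (dual V) V (TwoSidedDuality.rightDuality V)

lemma whiskerLeft_coevR_evR (V : C) :
    V ◁ coevR V ≫ (α_ _ _ _).inv ≫ evR V ▷ V = (ρ_ V).hom ≫ (λ_ V).inv :=
  @ExactPairing.coevaluation_evaluation C _ _ (dual V) V (TwoSidedDuality.rightDuality V)

lemma coevL_transposeL {U V : C} (g : U ⟶ V) :
    coevL V ≫ V ◁ transposeL g = coevL U ≫ g ▷ dual U := by
  calc
    _ = 𝟙 _ ⊗≫ (coevL V ▷ 𝟙_ C ≫ (V ⊗ dual V) ◁ (coevL U ≫ g ▷ dual U)) ⊗≫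
        V ◁ evL V ▷ dual U ⊗≫ 𝟙 _ := by
      dsimp only [transposeL]; monoidal
    _ = 𝟙 _ ⊗≫ coevL U ≫ g ▷ dual U ⊗≫ (coevL V ▷ V ⊗≫ V ◁ evL V) ▷ dual U ⊗≫ 𝟙 _ := by
      rw [← whisker_exchange]; monoidal
    _ = _ := by
      rw [coevL_evL]; monoidal

lemma transposeR_evR {U V : C} (g : U ⟶ V) :
    U ◁ transposeR g ≫ evR U = g ▷ dual V ≫ evR V := by
  calc
    _ = 𝟙 _ ⊗≫ U ◁ coevR U ▷ dual V ⊗≫ ((U ⊗ dual U) ◁ (g ▷ dual V ≫ evR V) ≫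
        evR U ▷ 𝟙_ C) ⊗≫ 𝟙 _ := by
      dsimp only [transposeR]; monoidal
    _ = 𝟙 _ ⊗≫ (U ◁ coevR U ⊗≫ evR U ▷ U) ▷ dual V ⊗≫ g ▷ dual V ≫ evR V ⊗≫ 𝟙 _ := by
      rw [whisker_exchange]; monoidal
    _ = _ := by
      rw [evR_coevR]; monoidal

lemma coevL_gammaL (V W : C) :
    coevL (V ⊗ W) =
      coevL V ⊗≫ V ◁ coevL W ▷ dual V ⊗≫ (V ⊗ W) ◁ gammaL V W := by
  symm
  calc
    _ = coevL V ⊗≫ V ◁ coevL W ▷ dual V ⊗≫ ((V ⊗ W) ⊗ dual W ⊗ dual V) ◁ coevL (V ⊗ W) ⊗≫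
        (V ⊗ W) ◁ dual W ◁ evL V ▷ (W ⊗ dual (V ⊗ W)) ⊗≫
        (V ⊗ W) ◁ evL W ▷ dual (V ⊗ W) ⊗≫ 𝟙 _ := by
      dsimp only [gammaL]; monoidal
    _ = 𝟙 _ ⊗≫ ((coevL V ⊗≫ V ◁ coevL W ▷ dual V) ▷ 𝟙_ C ≫
        (V ⊗ (W ⊗ dual W) ⊗ dual V) ◁ coevL (V ⊗ W)) ⊗≫
        (V ⊗ W) ◁ dual W ◁ evL V ▷ (W ⊗ dual (V ⊗ W)) ⊗≫
        (V ⊗ W) ◁ evL W ▷ dual (V ⊗ W) ⊗≫ 𝟙 _ := by monoidal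
    _ = 𝟙 _ ⊗≫ coevL (V ⊗ W) ⊗≫ coevL V ▷ (V ⊗ W ⊗ dual (V ⊗ W)) ⊗≫
        V ◁ (coevL W ▷ (dual V ⊗ V) ≫ (W ⊗ dual W) ◁ evL V) ▷ (W ⊗ dual (V ⊗ W)) ⊗≫
        V ◁ W ◁ evL W ▷ dual (V ⊗ W) ⊗≫ 𝟙 _ := by
      rw [← whisker_exchange]; monoidal
    _ = 𝟙 _ ⊗≫ coevL (V ⊗ W) ⊗≫ (coevL V ▷ V ⊗≫ V ◁ evL V) ▷ (W ⊗ dual (V ⊗ W)) ⊗≫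
        V ◁ (coevL W ▷ W ⊗≫ W ◁ evL W) ▷ dual (V ⊗ W) ⊗≫ 𝟙 _ := by
      rw [← whisker_exchange]; monoidal
    _ = _ := by
      rw [coevL_evL, coevL_evL]; monoidal

lemma gammaR_evR (V W : C) :
    (V ⊗ W) ◁ gammaR V W ≫ evR (V ⊗ W) =
      𝟙 _ ⊗≫ V ◁ evR W ▷ dual V ⊗≫ evR V := by
  calc
    _ = 𝟙 _ ⊗≫ (V ⊗ W) ◁ coevR (V ⊗ W) ▷ (dual W ⊗ dual V) ⊗≫
        (((V ⊗ W) ⊗ dual (V ⊗ W)) ◁ (V ◁ evR W ▷ dual V ⊗≫ evR V) ≫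
        evR (V ⊗ W) ▷ 𝟙_ C) ⊗≫ 𝟙 _ := by
      dsimp only [gammaR]; monoidal
    _ = 𝟙 _ ⊗≫ ((V ⊗ W) ◁ coevR (V ⊗ W) ≫ (α_ _ _ _).inv ≫ evR (V ⊗ W) ▷ (V ⊗ W)) ▷
        (dual W ⊗ dual V) ⊗≫ V ◁ evR W ▷ dual V ⊗≫ evR V := by
      rw [whisker_exchange]; monoidal
    _ = _ := by
      rw [whiskerLeft_coevR_evR]; monoidal

lemma rightPartialTrace_naturality {V V' X X' : C} (W : C) (x : V' ⟶ V) (g : V ⊗ W ⟶ X ⊗ W)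
    (y : X ⟶ X') :
    rightPartialTrace W (x ▷ W ≫ g ≫ y ▷ W) = x ≫ rightPartialTrace W g ≫ y := by
  dsimp only [rightPartialTrace]
  calc
    _ = 𝟙 _ ⊗≫ (V' ◁ coevL W ≫ x ▷ (W ⊗ dual W)) ⊗≫ g ▷ dual W ⊗≫
        (y ▷ (W ⊗ dual W) ≫ X' ◁ evR W) ⊗≫ 𝟙 _ := by monoidal
    _ = _ := by
      rw [whisker_exchange x, ← whisker_exchange y]; monoidal

lemma rightPartialTrace_naturality_left {V V' X : C} (W : C) (x : V' ⟶ V)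
    (g : V ⊗ W ⟶ X ⊗ W) : rightPartialTrace W (x ▷ W ≫ g) = x ≫ rightPartialTrace W g := by
  simpa using rightPartialTrace_naturality W x g (𝟙 X)

lemma rightPartialTrace_naturality_right {V X X' : C} (W : C) (g : V ⊗ W ⟶ X ⊗ W)
    (y : X ⟶ X') : rightPartialTrace W (g ≫ y ▷ W) = rightPartialTrace W g ≫ y := by
  simpa using rightPartialTrace_naturality W (𝟙 V) g y

/-- The partial trace of a composite is the composite of the two mates. -/
lemma rightPartialTrace_comp {V X Y : C} (W : C) (f : V ⊗ W ⟶ Y) (g : Y ⟶ X ⊗ W) :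
    rightPartialTrace W (f ≫ g) =
      letI := TwoSidedDuality.leftDuality W
      letI := TwoSidedDuality.rightDuality W
      tensorRightHomEquiv V W (dual W) Y f ≫ (tensorRightHomEquiv Y (dual W) W X).symm g := by
  simp [rightPartialTrace, tensorRightHomEquiv, coevL, evR]

end Duality

/-! ### Trace properties that need the pivotal structure -/

section Pivotal

variable {C : Type u} [Category.{v} C] [MonoidalCategory C] [PivotalCategory C]

/-- Slide `g` around the loop: it passes the cap as its right transpose and the cup as its left
transpose, and these agree. -/
lemma rightPartialTrace_cyclic {X Y U V : C} (x : X ⊗ V ⟶ Y ⊗ U) (g : U ⟶ V) :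
    rightPartialTrace V (x ≫ Y ◁ g) = rightPartialTrace U (X ◁ g ≫ x) := by
  dsimp only [rightPartialTrace]
  calc
    _ = 𝟙 _ ⊗≫ X ◁ coevL V ⊗≫ x ▷ dual V ⊗≫ Y ◁ (g ▷ dual V ≫ evR V) ⊗≫ 𝟙 _ := by monoidal
    _ = 𝟙 _ ⊗≫ X ◁ coevL V ⊗≫ (x ▷ dual V ≫ (Y ⊗ U) ◁ transposeR g) ⊗≫ Y ◁ evR U ⊗≫ 𝟙 _ := by
      rw [← transposeR_evR]; monoidal
    _ = 𝟙 _ ⊗≫ X ◁ (coevL V ≫ V ◁ transposeL g) ⊗≫ x ▷ dual U ⊗≫ Y ◁ evR U ⊗≫ 𝟙 _ := by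
      rw [← whisker_exchange, PivotalCategory.transpose_eq]; monoidal
    _ = _ := by
      rw [coevL_transposeL]; monoidal

/-- The loop on `U ⊗ W` is two nested loops once the cup is rewritten with `gammaL` and the cap with
`gammaR`, which are equal. -/
lemma rightPartialTrace_tensor {X Y : C} (U W : C) (f : X ⊗ (U ⊗ W) ⟶ Y ⊗ (U ⊗ W)) :
    rightPartialTrace (U ⊗ W) f =
      rightPartialTrace U (rightPartialTrace W ((α_ X U W).hom ≫ f ≫ (α_ Y U W).inv)) := by
  dsimp only [rightPartialTrace]
  rw [coevL_gammaL, PivotalCategory.gamma_eq]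
  calc
    _ = 𝟙 _ ⊗≫ X ◁ (coevL U ⊗≫ U ◁ coevL W ▷ dual U) ⊗≫
        ((X ⊗ (U ⊗ W)) ◁ gammaR U W ≫ f ▷ dual (U ⊗ W)) ⊗≫ Y ◁ evR (U ⊗ W) ⊗≫ 𝟙 _ := by
      monoidal
    _ = 𝟙 _ ⊗≫ X ◁ (coevL U ⊗≫ U ◁ coevL W ▷ dual U) ⊗≫
        f ▷ (dual W ⊗ dual U) ⊗≫ Y ◁ ((U ⊗ W) ◁ gammaR U W ≫ evR (U ⊗ W)) ⊗≫ 𝟙 _ := by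
      rw [whisker_exchange]; monoidal
    _ = _ := by
      rw [gammaR_evR]; monoidal

end Pivotal

section Linear

variable (k : Type w) [Field k] {C : Type u} [Category.{v} C] [Preadditive C] [Linear k C]
  [MonoidalCategory C] [MonoidalPreadditive C] [MonoidalLinear k C] [TwoSidedDuality C]

/-- The right partial trace as a linear map. -/
def rightPartialTraceLinear (V X W : C) : (V ⊗ W ⟶ X ⊗ W) →ₗ[k] (V ⟶ X) where
  toFun g := rightPartialTrace W g
  map_add' f g := by simp [rightPartialTrace, MonoidalPreadditive.add_whiskerRight]
  map_smul' c f := by simp [rightPartialTrace, MonoidalLinear.smul_whiskerRight]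

end Linear

/-! ### Finite-dimensional algebras without nontrivial idempotents -/

section Algebra

variable {A : Type*} [Ring A]

/-- In a finite-dimensional algebra without nontrivial idempotents every element is a unit or
nilpotent. -/
lemma isUnit_or_isNilpotent_of_idempotents (k : Type*) [Field k] [Algebra k A] [FiniteDimensional k A]
    (hA : ∀ e : A, e * e = e → e = 0 ∨ e = 1) (y : A) :
    IsUnit y ∨ IsNilpotent y := by
  have hp : minpoly k y ≠ 0 := minpoly.ne_zero (Algebra.IsIntegral.isIntegral y)
  obtain ⟨q, hq, hdvd⟩ :=
    Polynomial.exists_eq_pow_rootMultiplicity_mul_and_not_dvd (minpoly k y) hp 0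
  set m := Polynomial.rootMultiplicity 0 (minpoly k y)
  rw [map_zero, sub_zero] at hq hdvd
  -- The exponent is `m + 1`, not `m`, so that the Bézout idempotent `a' * y ^ (m + 1)` has a factor
  -- `y` even when `m = 0`; if it equals `1`, then `y` is a unit.
  have hcop : IsCoprime (Polynomial.X ^ (m + 1)) q :=
    ((Polynomial.irreducible_X.coprime_iff_not_dvd).2 hdvd).pow_left
  obtain ⟨a, b, hab⟩ := hcop
  have hzero : y ^ m * Polynomial.aeval y q = 0 := by
    have := minpoly.aeval k y
    rw [hq] at this
    simpa using this
  have hsum : Polynomial.aeval y a * y ^ (m + 1) + Polynomial.aeval y b * Polynomial.aeval y q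
      = 1 := by
    simpa using congrArg (Polynomial.aeval y) hab
  have hcomm (p : Polynomial k) : Commute y (Polynomial.aeval y p) := by
    simpa using (Commute.all Polynomial.X p).map (Polynomial.aeval y)
  set a' := Polynomial.aeval y a
  set b' := Polynomial.aeval y b
  set q' := Polynomial.aeval y q
  have hbq : y ^ m * (b' * q') = 0 := by
    rw [← mul_assoc, ((hcomm b).pow_left m).eq, mul_assoc, hzero, mul_zero]
  have hidem : (a' * y ^ (m + 1)) * (a' * y ^ (m + 1)) = a' * y ^ (m + 1) := by
    have h : a' * y ^ (m + 1) * (b' * q') = 0 := by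
      rw [pow_succ', mul_assoc, mul_assoc, hbq, mul_zero, mul_zero]
    calc _ = a' * y ^ (m + 1) * (a' * y ^ (m + 1) + b' * q') := by rw [mul_add, h, add_zero]
      _ = _ := by rw [hsum, mul_one]
  rcases hA _ hidem with h | h
  · right
    rw [h, zero_add] at hsum
    exact ⟨m, by simpa [hsum] using hbq⟩
  · left
    refine isUnit_iff_exists.2 ⟨a' * y ^ m, ?_, by rw [mul_assoc, ← pow_succ, h]⟩
    rw [← mul_assoc, (hcomm a).eq, mul_assoc, ← pow_succ', h]

/-- If a maximal left ideal misses `n`, then `a * n + i = 1` with `i` in it. A unit `a * n` would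
make the nilpotent `n` invertible, and a nilpotent one makes `i` invertible. -/
lemma mem_jacobson_of_isNilpotent (k : Type*) [Field k] [Algebra k A] [FiniteDimensional k A] [Nontrivial A]
    (hA : ∀ e : A, e * e = e → e = 0 ∨ e = 1) {n : A} (hn : IsNilpotent n) :
    n ∈ Ring.jacobson A := by
  have : IsArtinianRing A := isArtinian_of_tower k inferInstance
  rw [Ring.jacobson_eq_sInf_isMaximal, Submodule.mem_sInf]
  have : IsNoetherianRing A := isNoetherian_of_tower k inferInstance
  intro I hI
  by_contra hnI
  obtain ⟨a, i, hi, hai⟩ := Ideal.IsMaximal.exists_inv (I := I) hI hnI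
  rcases isUnit_or_isNilpotent_of_idempotents k hA (a * n) with h | h
  · have : IsUnit n := by
      obtain ⟨c, hc⟩ := h.exists_left_inv
      rw [← mul_assoc] at hc
      exact IsUnit.of_mul_eq_one _ (mul_eq_one_symm hc)
    exact this.not_isNilpotent hn
  · have : IsUnit i := by
      rw [← add_sub_cancel_left (a * n) i, hai]
      exact h.isUnit_one_sub
    exact hI.ne_top (Ideal.eq_top_of_isUnit_mem I hi this)

variable (A) in
lemma nonempty_quotient_jacobson_algEquiv (k : Type*) [Field k] [Algebra k A] [FiniteDimensional k A] [IsAlgClosed k] [Nontrivial A]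
    (hA : ∀ e : A, e * e = e → e = 0 ∨ e = 1) :
    Nonempty ((A ⧸ Ring.jacobson A) ≃ₐ[k] k) := by
  have : Nontrivial (A ⧸ Ring.jacobson A) :=
    Ideal.Quotient.nontrivial_iff.2 (Ring.jacobson_lt_top A).ne
  refine ⟨(AlgEquiv.ofBijective (Algebra.ofId k (A ⧸ Ring.jacobson A))
    ⟨(algebraMap k _).injective, fun x => ?_⟩).symm⟩
  obtain ⟨x, rfl⟩ := Ideal.Quotient.mk_surjective x
  obtain ⟨c, hc⟩ := spectrum.nonempty_of_isAlgClosed_of_finiteDimensional k x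
  refine ⟨c, ?_⟩
  change Ideal.Quotient.mk _ (algebraMap k A c) = _
  have hn := (isUnit_or_isNilpotent_of_idempotents k hA
    (algebraMap k A c - x)).resolve_left hc
  exact (Ideal.Quotient.eq).2 (mem_jacobson_of_isNilpotent k hA hn)

variable (A) in
lemma isNilpotent_jacobson (k : Type*) [Field k] [Algebra k A] [FiniteDimensional k A] : IsNilpotent (Ring.jacobson A) :=
  have : IsArtinianRing A := isArtinian_of_tower k inferInstance
  IsSemiprimaryRing.isNilpotent

end Algebra

/-! ### Simple subobjects and quotients without finite length -/

section Abelian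

open Limits

variable {C : Type u} [Category.{v} C] [Abelian C]

lemma idempotent_of_indecomposable {P : C} (hP : Indecomposable P) (e : P ⟶ P)
    (he : e ≫ e = e) : e = 0 ∨ e = 𝟙 P := by
  obtain ⟨Y, i, r, hir, hri⟩ := IsIdempotentComplete.idempotents_split P e he
  obtain ⟨Z, j, s, hjs, hsj⟩ := IsIdempotentComplete.idempotents_split P (𝟙 P - e) (by simp [he])
  have : IsSplitMono i := ⟨⟨⟨r, hir⟩⟩⟩
  have : IsSplitMono j := ⟨⟨⟨s, hjs⟩⟩⟩
  have his : i ≫ s = 0 := by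
    rw [← cancel_mono j, Category.assoc, hsj, ← hri]
    simp [reassoc_of% hir]
  have hjr : j ≫ r = 0 := by
    rw [← cancel_mono i, Category.assoc, hri, show e = 𝟙 P - s ≫ j by rw [hsj]; simp]
    simp [reassoc_of% hjs]
  rcases hP.2 Y Z ⟨biprod.lift r s, biprod.desc i j,
    by simp [hri, hsj], by ext <;> simp [hir, his, hjr, hjs]⟩ with h | h
  · left
    rw [← hri, h.eq_of_tgt r 0, zero_comp]
  · right
    rw [h.eq_of_tgt s 0, zero_comp, eq_comm, sub_eq_zero] at hsj
    exact hsj.symm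

/-- An object all of whose nonzero subquotients receive a nonzero morphism from `R`. -/
def SubquotientsDetectedBy (R V : C) : Prop :=
  ∀ ⦃K Y : C⦄ (i : K ⟶ V) (p : K ⟶ Y), Mono i → Epi p → ¬ IsZero Y → ∃ f : R ⟶ Y, f ≠ 0

variable {k : Type w} [Field k] [Linear k C]

/-- Take a nonzero subobject `a` with `dim Hom(R, a)` minimal. For a proper `K` in `a`, a nonzero `R
⟶ a/K` lifts to a map `R ⟶ a` outside `Hom(R, K)`, so `K` has smaller dimension. -/
lemma exists_simple_subobject (hfin : LocallyFinite k C) {R V : C} [Projective R]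
    (hV : SubquotientsDetectedBy R V) (h0 : ¬ IsZero V) :
    ∃ (a : C) (η : a ⟶ V), Simple a ∧ Mono η := by
  let S : Set ℕ := {n | ∃ (a : C) (η : a ⟶ V), Mono η ∧ ¬ IsZero a ∧
    Module.finrank k (R ⟶ a) = n}
  obtain ⟨n, ⟨a, η, hη, ha, hn⟩, hmin⟩ :=
    WellFounded.has_min (α := ℕ) wellFounded_lt S ⟨_, V, 𝟙 V, inferInstance, h0, rfl⟩
  refine ⟨a, η, ⟨fun {K} f hf => ⟨fun hiso hf0 => ?_, fun hf0 => ?_⟩⟩, hη⟩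
  · exact ha (IsZero.of_epi_eq_zero f hf0)
  · by_contra hiso
    have hK : ¬ IsZero K := fun h => hf0 (h.eq_of_src _ _)
    have hcok : ¬ IsZero (cokernel f) := fun h => by
      have : Epi f := Preadditive.epi_of_cokernel_zero (h.eq_of_tgt _ _)
      exact hiso (isIso_of_mono_of_epi f)
    obtain ⟨g, hg⟩ := hV η (cokernel.π f) hη inferInstance hcok
    refine hmin _ ⟨K, f ≫ η, mono_comp _ _, hK, rfl⟩ ?_
    rw [← hn]
    have := hfin R a
    have := hfin R K
    have hinj : Function.Injective (Linear.rightComp k R f) := fun x y h => by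
      simpa [cancel_mono] using h
    rw [← LinearMap.finrank_range_of_inj hinj]
    refine Submodule.finrank_lt fun htop => hg ?_
    obtain ⟨x, hx⟩ : Projective.factorThru g (cokernel.π f) ∈
        LinearMap.range (Linear.rightComp k R f) := htop ▸ Submodule.mem_top
    rw [← Projective.factorThru_comp g (cokernel.π f), ← hx]
    simp

lemma exists_simple_quotient (hfin : LocallyFinite k C) {R V : C} [Projective R]
    (hV : SubquotientsDetectedBy R V) (h0 : ¬ IsZero V) :
    ∃ (b : C) (ε : V ⟶ b), Simple b ∧ Epi ε := by
  let S : Set ℕ := {n | ∃ (b : C) (ε : V ⟶ b), Epi ε ∧ ¬ IsZero b ∧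
    Module.finrank k (R ⟶ b) = n}
  obtain ⟨n, ⟨b, ε, hε, hb, hn⟩, hmin⟩ :=
    WellFounded.has_min (α := ℕ) wellFounded_lt S ⟨_, V, 𝟙 V, inferInstance, h0, rfl⟩
  refine ⟨b, ε, ⟨fun {K} f hf => ⟨fun hiso hf0 => ?_, fun hf0 => ?_⟩⟩, hε⟩
  · exact hb (IsZero.of_epi_eq_zero f hf0)
  · by_contra hiso
    have hK : ¬ IsZero K := fun h => hf0 (h.eq_of_src _ _)
    have hcok : ¬ IsZero (cokernel f) := fun h => by
      have : Epi f := Preadditive.epi_of_cokernel_zero (h.eq_of_tgt _ _)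
      exact hiso (isIso_of_mono_of_epi f)
    -- The preimage of `K` in `V` exhibits `K` as a subquotient of `V`; the resulting map `R ⟶ K` is
    -- lost on passing to `b/K`.
    obtain ⟨g, hg⟩ := hV (pullback.snd f ε) (pullback.fst f ε) inferInstance inferInstance hK
    refine hmin _ ⟨cokernel f, ε ≫ cokernel.π f, epi_comp _ _, hcok, rfl⟩ ?_
    rw [← hn]
    have := hfin R b
    have := hfin R (cokernel f)
    have hsurj : LinearMap.range (Linear.rightComp k R (cokernel.π f)) = ⊤ :=
      LinearMap.range_eq_top.2 fun x => ⟨Projective.factorThru x (cokernel.π f), by simp⟩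
    have hsum := (Linear.rightComp k R (cokernel.π f)).finrank_range_add_finrank_ker
    rw [hsurj, finrank_top] at hsum
    have hpos : 0 < Module.finrank k (LinearMap.ker (Linear.rightComp k R (cokernel.π f))) := by
      refine Module.finrank_pos_iff_exists_ne_zero.2 ⟨⟨g ≫ f, by simp⟩, fun h => hg ?_⟩
      rw [← cancel_mono f, zero_comp]
      exact congrArg Subtype.val h
    omega

end Abelian

/-! ### Exactness of the tensor product and duals of projectives -/

section Rigid

variable {C : Type u} [Category.{v} C] [MonoidalCategory C] [TwoSidedDuality C]

instance isRightAdjoint_tensorRight (V : C) : (tensorRight V).IsRightAdjoint :=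
  letI := TwoSidedDuality.rightDuality V
  (tensorRightAdjunction (dual V) V).isRightAdjoint

instance isLeftAdjoint_tensorRight (V : C) : (tensorRight V).IsLeftAdjoint :=
  letI := TwoSidedDuality.leftDuality V
  (tensorRightAdjunction V (dual V)).isLeftAdjoint

instance isRightAdjoint_tensorLeft (V : C) : (tensorLeft V).IsRightAdjoint :=
  letI := TwoSidedDuality.leftDuality V
  (tensorLeftAdjunction V (dual V)).isRightAdjoint

instance isLeftAdjoint_tensorLeft (V : C) : (tensorLeft V).IsLeftAdjoint :=
  letI := TwoSidedDuality.rightDuality V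
  (tensorLeftAdjunction (dual V) V).isLeftAdjoint

instance mono_whiskerRight {X Y : C} (f : X ⟶ Y) [Mono f] (V : C) : Mono (f ▷ V) :=
  inferInstanceAs (Mono ((tensorRight V).map f))

instance epi_whiskerRight {X Y : C} (f : X ⟶ Y) [Epi f] (V : C) : Epi (f ▷ V) :=
  inferInstanceAs (Epi ((tensorRight V).map f))

instance mono_whiskerLeft {X Y : C} (f : X ⟶ Y) [Mono f] (V : C) : Mono (V ◁ f) :=
  inferInstanceAs (Mono ((tensorLeft V).map f))

instance epi_whiskerLeft {X Y : C} (f : X ⟶ Y) [Epi f] (V : C) : Epi (V ◁ f) :=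
  inferInstanceAs (Epi ((tensorLeft V).map f))

lemma projective_tensor_right {V : C} (hV : Projective V) (W : C) : Projective (V ⊗ W) :=
  isRightIdeal_projective.tensor hV W

/-- The zigzag identity makes `V*` a retract of `V* ⊗ V ⊗ V*`. -/
lemma projective_dual {V : C} (hV : Projective V) : Projective (dual V) := by
  refine isRightIdeal_projective.retract
    (projective_tensor_left (dual V) (projective_tensor_right hV (dual V)))
    ((ρ_ _).inv ≫ dual V ◁ coevL V) ((α_ _ _ _).inv ≫ evL V ▷ dual V ≫ (λ_ _).hom) ?_
  calc
    _ = 𝟙 _ ⊗≫ (dual V ◁ coevL V ⊗≫ evL V ▷ dual V) ⊗≫ 𝟙 _ := by monoidal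
    _ = _ := by rw [evL_coevL]; monoidal

/-- The mate `𝟙 ⟶ U*` of a morphism `U ⟶ 𝟙`. -/
def unitMate {U : C} (i : U ⟶ 𝟙_ C) : 𝟙_ C ⟶ dual U :=
  coevL U ≫ i ▷ dual U ≫ (λ_ _).hom

lemma unitMate_comp {U X : C} (i : U ⟶ 𝟙_ C) (c : dual U ⟶ X) :
    unitMate i ≫ c = (coevL U ≫ U ◁ c) ≫ i ▷ X ≫ (λ_ X).hom := by
  rw [unitMate, Category.assoc, Category.assoc, ← leftUnitor_naturality,
    ← whisker_exchange_assoc, Category.assoc]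

end Rigid

/-! ### Projectives are injective; the unit is simple -/

section Abelian

open Limits

variable {C : Type u} [Category.{v} C] [Abelian C] [MonoidalCategory C] [TwoSidedDuality C]

/-- If `U ⟶ 𝟙 ⟶ V` vanishes, with the first arrow mono and the second one epi, then
`U ⊗ V = 0`. -/
lemma isZero_tensor_of_comp_eq_zero {U V : C} (i : U ⟶ 𝟙_ C) (p : 𝟙_ C ⟶ V) [Mono i] [Epi p]
    (h : i ≫ p = 0) : IsZero (U ⊗ V) := by
  have h1 : U ◁ p ≫ i ▷ V = 0 := by
    have : i ▷ 𝟙_ C ≫ (λ_ (𝟙_ C)).hom = (ρ_ U).hom ≫ i := by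
      rw [unitors_equal, rightUnitor_naturality]
    rw [whisker_exchange, ← cancel_mono (λ_ V).hom, Category.assoc, leftUnitor_naturality,
      reassoc_of% this, h]
    simp
  have h2 : U ◁ p = 0 := by rwa [← cancel_mono (i ▷ V), zero_comp]
  exact IsZero.of_epi_eq_zero _ h2

variable [MonoidalPreadditive C]

/-- Tensoring is exact, and the cokernel tensored with `V` is projective. -/
lemma splitMono_whiskerRight {X Y : C} (i : X ⟶ Y) [Mono i] {V : C} (hV : Projective V) :
    ∃ s : Y ⊗ V ⟶ X ⊗ V, i ▷ V ≫ s = 𝟙 (X ⊗ V) := by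
  have hS : (ShortComplex.mk i (cokernel.π i) (by simp)).ShortExact :=
    { exact := ShortComplex.exact_cokernel i }
  have hS' := hS.map_of_exact (tensorRight V)
  have : Projective ((ShortComplex.mk i (cokernel.π i) (by simp)).map (tensorRight V)).X₃ :=
    projective_tensor_left (cokernel i) hV
  exact ⟨hS'.splittingOfProjective.r, hS'.splittingOfProjective.f_r⟩

lemma splitMono_whiskerLeft {X Y : C} (i : X ⟶ Y) [Mono i] {V : C} (hV : Projective V) :
    ∃ s : V ⊗ Y ⟶ V ⊗ X, V ◁ i ≫ s = 𝟙 (V ⊗ X) := by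
  have hS : (ShortComplex.mk i (cokernel.π i) (by simp)).ShortExact :=
    { exact := ShortComplex.exact_cokernel i }
  have hS' := hS.map_of_exact (tensorLeft V)
  have : Projective ((ShortComplex.mk i (cokernel.π i) (by simp)).map (tensorLeft V)).X₃ :=
    projective_tensor_right hV (cokernel i)
  exact ⟨hS'.splittingOfProjective.r, hS'.splittingOfProjective.f_r⟩

/-- Extending along `f` into `V` is, by adjunction, extending along `f ▷ dual V` into `𝟙`, and that
morphism splits. -/
lemma injective_of_projective {V : C} (hV : Projective V) : Injective V where
  factors {X Y} g f hf := by
    let _ := TwoSidedDuality.rightDuality V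
    obtain ⟨s, hs⟩ := splitMono_whiskerRight f (projective_dual hV)
    refine ⟨tensorRightHomEquiv Y (dual V) V (𝟙_ C)
      (s ≫ (tensorRightHomEquiv X (dual V) V (𝟙_ C)).symm (g ≫ (λ_ V).inv)) ≫ (λ_ V).hom, ?_⟩
    rw [← Category.assoc, ← Iso.eq_comp_inv,
      ← (tensorRightHomEquiv X (dual V) V (𝟙_ C)).symm.injective.eq_iff,
      tensorRightHomEquiv_symm_naturality, Equiv.symm_apply_apply, reassoc_of% hs]

/-- `Q ⊗ K` is a retract of `Q ⊗ V`, and it maps onto `K` and then onto `Y`. -/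
lemma subquotientsDetectedBy_tensor {Q : C} (hQ : Projective Q) (q : Q ⟶ 𝟙_ C) [Epi q] (V : C)
    {K Y : C} (i : K ⟶ V) (p : K ⟶ Y) [Mono i] [Epi p] (hY : ¬ IsZero Y) :
    ∃ f : Q ⊗ V ⟶ Y, f ≠ 0 := by
  obtain ⟨s, hs⟩ := splitMono_whiskerLeft i hQ
  refine ⟨s ≫ q ▷ K ≫ (λ_ K).hom ≫ p, fun h => hY ?_⟩
  have h' : q ▷ K ≫ (λ_ K).hom ≫ p = 0 := by
    simpa [reassoc_of% hs] using congrArg (fun f => Q ◁ i ≫ f) h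
  exact IsZero.of_epi_eq_zero _ h'

/-- With `U ⊗ 𝟙/U = 0`, the map `U ⊗ U ⟶ U ⊗ 𝟙` is epi. -/
lemma isZero_of_tensor_self {U : C} (i : U ⟶ 𝟙_ C) [Mono i] (h : IsZero (U ⊗ U)) : IsZero U := by
  have hz := isZero_tensor_of_comp_eq_zero i (cokernel.π i) (by simp)
  have : Epi (U ◁ i) := by
    have hS : (ShortComplex.mk i (cokernel.π i) (by simp)).ShortExact :=
      { exact := ShortComplex.exact_cokernel i }
    have hS' := hS.map_of_exact (tensorLeft U)
    exact (hS'.exact.epi_f (hz.eq_of_tgt _ _) : Epi ((tensorLeft U).map i))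
  exact (IsZero.of_epi (U ◁ i) h).of_iso (ρ_ U).symm

lemma eq_zero_of_coevL_comp {U X : C} (c : dual U ⟶ X) (h : coevL U ≫ U ◁ c = 0) : c = 0 := by
  calc
    c = 𝟙 _ ⊗≫ (dual U ◁ coevL U ⊗≫ evL U ▷ dual U) ⊗≫ c := by
      rw [evL_coevL]; monoidal
    _ = 𝟙 _ ⊗≫ dual U ◁ coevL U ⊗≫ (evL U ▷ dual U ≫ 𝟙_ C ◁ c) ⊗≫ 𝟙 _ := by monoidal
    _ = 𝟙 _ ⊗≫ dual U ◁ (coevL U ≫ U ◁ c) ⊗≫ evL U ▷ X ⊗≫ 𝟙 _ := by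
      rw [← whisker_exchange]; monoidal
    _ = 0 := by rw [h]; simp [monoidalComp]

lemma epi_unitMate {U : C} (i : U ⟶ 𝟙_ C) [Mono i] : Epi (unitMate i) := by
  refine Preadditive.epi_of_cancel_zero _ fun {X} c hc => eq_zero_of_coevL_comp c ?_
  rwa [← cancel_mono (i ▷ X ≫ (λ_ X).hom), zero_comp, ← unitMate_comp]

/-- The cokernel `W` is a quotient of `𝟙` killed by `U`, so `U ⊗ W = 0`; taking mates, the
projection from `U*` to `W` vanishes. -/
lemma epi_comp_unitMate {U : C} (i : U ⟶ 𝟙_ C) [Mono i] : Epi (i ≫ unitMate i) := by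
  have := epi_unitMate i
  refine Preadditive.epi_of_cokernel_zero ?_
  have hW := isZero_tensor_of_comp_eq_zero i (unitMate i ≫ cokernel.π (i ≫ unitMate i)) (by
    rw [← Category.assoc, cokernel.condition])
  exact eq_zero_of_coevL_comp _ (hW.eq_of_tgt _ _)

lemma mono_comp_unitMate {U : C} (i : U ⟶ 𝟙_ C) [Mono i] : Mono (i ≫ unitMate i) := by
  refine Preadditive.mono_of_kernel_zero ?_
  obtain ⟨K, j, hj, hjm, hji⟩ : ∃ (K : C) (j : K ⟶ U), (IsZero K → kernel.ι (i ≫ unitMate i) = 0) ∧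
      Mono j ∧ j ≫ i ≫ unitMate i = 0 :=
    ⟨_, kernel.ι (i ≫ unitMate i), fun h => h.eq_of_src _ _, inferInstance, kernel.condition _⟩
  -- Evaluating `i ≫ unitMate i` against `U` gives the multiplication `U ⊗ U ⟶ 𝟙`, so the kernel
  -- annihilates `U`, hence itself.
  have h1 : (j ≫ i) ▷ U ≫ (λ_ U).hom ≫ i = 0 := by
    have h : (j ≫ i ≫ unitMate i) ▷ U ≫ evL U = (j ≫ i) ▷ U ≫ (λ_ U).hom ≫ i := by
      calc
        _ = (j ≫ i) ▷ U ⊗≫ coevL U ▷ U ⊗≫ (i ▷ (dual U ⊗ U) ≫ 𝟙_ C ◁ evL U) ⊗≫ 𝟙 _ := by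
          dsimp only [unitMate]; monoidal
        _ = (j ≫ i) ▷ U ⊗≫ (coevL U ▷ U ⊗≫ U ◁ evL U) ⊗≫ i ⊗≫ 𝟙 _ := by
          rw [← whisker_exchange]; monoidal
        _ = _ := by
          rw [coevL_evL]; monoidal
    rw [← h, hji]
    simp
  have h2 : (j ≫ i) ▷ U = 0 := by rwa [← cancel_mono ((λ_ U).hom ≫ i), zero_comp]
  have hKU : IsZero (K ⊗ U) := IsZero.of_mono_eq_zero _ h2
  have hKK : IsZero (K ⊗ K) := IsZero.of_mono (K ◁ j) hKU
  exact hj (isZero_of_tensor_self (j ≫ i) hKK)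

/-- For nonzero `U` in `𝟙`, the composite `U ⟶ 𝟙 ⟶ U*` is an isomorphism, so `U` is a summand of
`𝟙`; its idempotent is a scalar fixing `i`, hence the identity. -/
lemma simple_unit {k : Type w} [Field k] [Linear k C]
    (hunit : AbsolutelyIrreducible k (𝟙_ C)) : Simple (𝟙_ C) where
  mono_isIso_iff_nonzero {U} i hi := by
    have hone : 𝟙 (𝟙_ C) ≠ 0 := fun h => by
      have := @hunit.1 0 1 (by simp [h])
      exact zero_ne_one this
    refine ⟨fun hiso hi0 => hone ?_, fun hi0 => ?_⟩
    · rw [← IsIso.inv_hom_id i, ← Category.comp_id (inv i ≫ i), Category.assoc]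
      simp [hi0]
    · have := epi_comp_unitMate i
      have := mono_comp_unitMate i
      have : IsIso (i ≫ unitMate i) := isIso_of_mono_of_epi _
      set r := unitMate i ≫ inv (i ≫ unitMate i)
      have hir : i ≫ r = 𝟙 U := by rw [← Category.assoc, IsIso.hom_inv_id]
      obtain ⟨c, hc⟩ := hunit.2 (r ≫ i)
      have hci : c • i = i := by
        have : i ≫ r ≫ i = i := by rw [← Category.assoc, hir, Category.id_comp]
        rw [← hc] at this
        simpa using this
      have hc1 : c = 1 := by
        by_contra hne
        refine hi0 ?_
        have : (c - 1) • i = 0 := by rw [sub_smul, hci, one_smul, sub_self]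
        exact (smul_eq_zero.1 this).resolve_left (sub_ne_zero.2 hne)
      exact ⟨r, hir, by rw [← hc, hc1]; simp⟩

end Abelian

/-! ### The linear form of a trace tuple -/

section TraceTuple

variable {k : Type w} [Field k] {C : Type u} [Category.{v} C] [Preadditive C] [Linear k C]
  {P a b : C} {η : a ⟶ P} {ε : P ⟶ b}

lemma comp_eq_zero_of_isNilpotent {n : P ⟶ P} (hn : IsNilpotent (End.of n)) {c : k}
    (h : η ≫ n = c • η) : η ≫ n = 0 := by
  obtain ⟨m, hm⟩ := hn
  have hpow (m : ℕ) : η ≫ (End.of n ^ m).asHom = c ^ m • η := by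
    induction m with
    | zero => simp [End.one_def]
    | succ m ih =>
      rw [pow_succ, End.mul_def]
      change η ≫ n ≫ (End.of n ^ m).asHom = _
      rw [← Category.assoc, h, Linear.smul_comp, ih, smul_smul, pow_succ']
  have h0 := hpow m
  rw [hm] at h0
  rcases smul_eq_zero.1 (h0.symm.trans Limits.comp_zero) with h1 | h1
  · rw [h, eq_zero_of_pow_eq_zero h1, zero_smul]
  · rw [h1, Limits.zero_comp]

lemma comp_eq_zero_of_isNilpotent' {n : P ⟶ P} (hn : IsNilpotent (End.of n)) {c : k}
    (h : n ≫ ε = c • ε) : n ≫ ε = 0 := by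
  obtain ⟨m, hm⟩ := hn
  have hpow (m : ℕ) : (End.of n ^ m).asHom ≫ ε = c ^ m • ε := by
    induction m with
    | zero => simp [End.one_def]
    | succ m ih =>
      rw [pow_succ', End.mul_def]
      change ((End.of n ^ m).asHom ≫ n) ≫ ε = _
      rw [Category.assoc, h, Linear.comp_smul, ih, smul_smul, pow_succ']
  have h0 := hpow m
  rw [hm] at h0
  rcases smul_eq_zero.1 (h0.symm.trans Limits.zero_comp) with h1 | h1
  · rw [h, eq_zero_of_pow_eq_zero h1, zero_smul]
  · rw [h1, Limits.comp_zero]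

lemma isNilpotent_of_mem_jacobson {A : Type*} [Ring A] (hA : IsNilpotent (Ring.jacobson A)) {n : A}
    (hn : n ∈ Ring.jacobson A) : IsNilpotent n := by
  obtain ⟨m, hm⟩ := hA
  exact ⟨m, by simpa [hm] using Ideal.pow_mem_pow hn m⟩

lemma exists_sub_algebraMap_mem {A : Type*} [Ring A] [Algebra k A] {J : Ideal A} [J.IsTwoSided]
    (e : (A ⧸ J) ≃ₐ[k] k) (x : A) : ∃ c : k, x - algebraMap k A c ∈ J := by
  refine ⟨e (Ideal.Quotient.mk J x), (Ideal.Quotient.eq).1 (e.injective ?_)⟩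
  exact (e.commutes (e (Ideal.Quotient.mk J x))).symm

namespace IsTraceTuple

/-- An endomorphism of `P` acts on `η` and on `ε` by the same scalar. -/
lemma exists_scalar (h : IsTraceTuple k η ε) (f : P ⟶ P) :
    ∃ c : k, η ≫ f = c • η ∧ f ≫ ε = c • ε := by
  obtain ⟨e⟩ := h.absolutely_indecomposable
  obtain ⟨c, hc⟩ := exists_sub_algebraMap_mem e (End.of f)
  have hn := isNilpotent_of_mem_jacobson h.end_nilpotent hc
  have hf : End.of (f - c • 𝟙 P) = End.of f - algebraMap k (End P) c := by
    rw [Algebra.algebraMap_eq_smul_one]; rfl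
  rw [← hf] at hn
  obtain ⟨x, hx, -⟩ := h.eta_generates (η ≫ (f - c • 𝟙 P))
  obtain ⟨y, hy, -⟩ := h.eps_generates ((f - c • 𝟙 P) ≫ ε)
  have h1 := comp_eq_zero_of_isNilpotent hn hx
  have h2 := comp_eq_zero_of_isNilpotent' hn hy
  refine ⟨c, ?_, ?_⟩
  · simpa [sub_eq_zero] using h1
  · simpa [sub_eq_zero] using h2

lemma bijective_smul_eta (h : IsTraceTuple k η ε) :
    Function.Bijective (LinearMap.toSpanSingleton k (a ⟶ P) η) := by
  refine ⟨fun x y hxy => ?_, fun g => ?_⟩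
  · obtain ⟨z, -, hz⟩ := h.eta_generates (x • η)
    rw [hz x rfl, hz y hxy]
  · obtain ⟨c, hc, -⟩ := h.eta_generates g
    exact ⟨c, hc.symm⟩

/-- The coordinate of a morphism `a ⟶ P` with respect to `η`. -/
noncomputable def etaCoord (h : IsTraceTuple k η ε) : (a ⟶ P) →ₗ[k] k :=
  (LinearEquiv.ofBijective (LinearMap.toSpanSingleton k (a ⟶ P) η)
    h.bijective_smul_eta).symm.toLinearMap

lemma etaCoord_smul (h : IsTraceTuple k η ε) (g : a ⟶ P) : h.etaCoord g • η = g :=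
  (LinearEquiv.ofBijective (LinearMap.toSpanSingleton k (a ⟶ P) η) h.bijective_smul_eta).apply_symm_apply g

variable [MonoidalCategory C] [TwoSidedDuality C]

lemma exists_scalar_rightPartialTrace (h : IsTraceTuple k η ε) {V : C} (F : P ⊗ V ⟶ P ⊗ V) :
    ∃ c : k, rightPartialTrace V (η ▷ V ≫ F) = c • η ∧
      rightPartialTrace V (F ≫ ε ▷ V) = c • ε := by
  rw [rightPartialTrace_naturality_left, rightPartialTrace_naturality_right]
  exact h.exists_scalar _

variable [MonoidalPreadditive C] [MonoidalLinear k C]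

/-- The linear form on `Hom(a ⊗ V, b ⊗ V)` defined by a trace tuple, for `V` in its ideal. -/
noncomputable def form (h : IsTraceTuple k η ε) {V : C} (hV : traceIdeal η ε V) :
    (a ⊗ V ⟶ b ⊗ V) →ₗ[k] k :=
  h.etaCoord ∘ₗ rightPartialTraceLinear k a P V ∘ₗ Linear.rightComp k (a ⊗ V) hV.2.choose

lemma form_eps (h : IsTraceTuple k η ε) {V : C} (hV : traceIdeal η ε V) (f : a ⊗ V ⟶ b ⊗ V)
    (σ : P ⊗ V ⟶ a ⊗ V) (hσ : η ▷ V ≫ σ = 𝟙 (a ⊗ V)) :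
    rightPartialTrace V (σ ≫ f) = h.form hV f • ε := by
  -- On `P ⊗ V`, precomposing this endomorphism with `η` cancels `σ`, and postcomposing it with `ε`
  -- cancels the chosen section.
  obtain ⟨c, hc, hc'⟩ := h.exists_scalar_rightPartialTrace (σ ≫ f ≫ hV.2.choose)
  rw [reassoc_of% hσ] at hc
  rw [Category.assoc, Category.assoc, hV.2.choose_spec, Category.comp_id] at hc'
  have : c • η = h.form hV f • η := by
    rw [← hc]
    exact (h.etaCoord_smul _).symm
  rw [hc', smul_left_injective k h.eta_ne_zero this]

lemma form_eta (h : IsTraceTuple k η ε) {V : C} (hV : traceIdeal η ε V) (f : a ⊗ V ⟶ b ⊗ V)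
    (τ : b ⊗ V ⟶ P ⊗ V) (hτ : τ ≫ ε ▷ V = 𝟙 (b ⊗ V)) :
    rightPartialTrace V (f ≫ τ) = h.form hV f • η := by
  obtain ⟨σ, hσ⟩ := hV.1
  obtain ⟨c, hc, hc'⟩ := h.exists_scalar_rightPartialTrace (σ ≫ f ≫ τ)
  rw [reassoc_of% hσ] at hc
  rw [Category.assoc, Category.assoc, hτ, Category.comp_id, h.form_eps hV f σ hσ] at hc'
  rw [hc, smul_left_injective k h.eps_ne_zero hc']

lemma form_eq_of_scalar (h : IsTraceTuple k η ε) {V : C} (hV : traceIdeal η ε V)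
    {f : a ⊗ V ⟶ b ⊗ V} {τ : b ⊗ V ⟶ P ⊗ V} (hτ : τ ≫ ε ▷ V = 𝟙 (b ⊗ V)) {c : k}
    (hc : rightPartialTrace V (f ≫ τ) = c • η) : h.form hV f = c :=
  smul_left_injective k h.eta_ne_zero ((h.form_eta hV f τ hτ).symm.trans hc)

end IsTraceTuple

end TraceTuple

/-! ### The trace axioms and uniqueness -/

section AssociatedTrace

variable {k : Type w} [Field k] {C : Type u} [Category.{v} C] [Preadditive C] [Linear k C]
  [MonoidalCategory C] [MonoidalPreadditive C] [MonoidalLinear k C] [PivotalCategory C]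
  {P a b : C} {η : a ⟶ P} {ε : P ⟶ b}

namespace IsTraceTuple

lemma form_tensor (h : IsTraceTuple k η ε) {U W : C} (hU : traceIdeal η ε U)
    (hUW : traceIdeal η ε (U ⊗ W)) (f : a ⊗ (U ⊗ W) ⟶ b ⊗ (U ⊗ W)) :
    h.form hUW f = h.form hU (rightPartialTrace W ((α_ a U W).hom ≫ f ≫ (α_ b U W).inv)) := by
  obtain ⟨τ, hτ⟩ := hU.2
  -- A section over `U` whiskered by `W` serves over `U ⊗ W`, and it pulls out of the partial trace
  -- over `W`.
  refine h.form_eq_of_scalar hUW (τ := (α_ b U W).inv ≫ τ ▷ W ≫ (α_ P U W).hom) ?_ ?_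
  · rw [Category.assoc, Category.assoc, ← associator_naturality_left, ← comp_whiskerRight_assoc,
      hτ]
    simp
  · rw [← h.form_eta hU _ τ hτ, ← rightPartialTrace_naturality_right, rightPartialTrace_tensor]
    simp

lemma form_cyclic (h : IsTraceTuple k η ε) {U V : C} (hU : traceIdeal η ε U)
    (hV : traceIdeal η ε V) (f : a ⊗ V ⟶ b ⊗ U) (g : U ⟶ V) :
    h.form hV (f ≫ b ◁ g) = h.form hU (a ◁ g ≫ f) := by
  obtain ⟨σ, hσ⟩ := hV.1
  obtain ⟨τ, hτ⟩ := hU.2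
  -- One endomorphism of `P ⊗ U` sees both sides: its `η` end gives `a ◁ g ≫ f`, its `ε` end gives
  -- `f ≫ b ◁ g` after a cyclic move.
  obtain ⟨c, hc, hc'⟩ := h.exists_scalar_rightPartialTrace (P ◁ g ≫ σ ≫ f ≫ τ)
  rw [← whisker_exchange_assoc, reassoc_of% hσ, ← Category.assoc, h.form_eta hU _ τ hτ] at hc
  simp only [Category.assoc, hτ, Category.comp_id] at hc'
  rw [← rightPartialTrace_cyclic, Category.assoc, h.form_eps hV _ σ hσ] at hc'
  rw [smul_left_injective k h.eps_ne_zero hc', smul_left_injective k h.eta_ne_zero hc]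

/-- The right trace on projective objects defined by a trace tuple. -/
noncomputable def rightTrace (h : IsTraceTuple k η ε) (hI : isProjective C ≤ traceIdeal η ε) :
    RightTrace k (isRightIdeal_projective (C := C)) a b where
  tr _ hV := h.form (hI _ hV)
  partial_trace _ _ hU f := h.form_tensor (hI _ hU) _ f
  cyclic _ _ hU hV f g := h.form_cyclic (hI _ hU) (hI _ hV) f g

lemma isAssociatedTrace_rightTrace (h : IsTraceTuple k η ε)
    (hI : isProjective C ≤ traceIdeal η ε) :
    IsAssociatedTrace k η ε (h.rightTrace hI) where
  eq_eta V hV f τ hτ := h.form_eta (hI V hV) f τ hτ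
  eq_eps V hV f σ hσ := h.form_eps (hI V hV) f σ hσ

lemma existsUnique_rightTrace (h : IsTraceTuple k η ε) (hI : isProjective C ≤ traceIdeal η ε) :
    ∃! t : RightTrace k (isRightIdeal_projective (C := C)) a b, IsAssociatedTrace k η ε t := by
  refine ⟨h.rightTrace hI, h.isAssociatedTrace_rightTrace hI, fun t ht => ?_⟩
  have htr : t.tr = (h.rightTrace hI).tr := by
    funext V hV
    ext f
    obtain ⟨τ, hτ⟩ := (hI V hV).2
    exact (h.form_eq_of_scalar (hI V hV) hτ (ht.eq_eta V hV f τ hτ)).symm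
  cases t
  congr

end IsTraceTuple

end AssociatedTrace

/-! ### Nondegeneracy, Calabi–Yau structure and Serre duality -/

section Nondegenerate

lemma ne_zero_of_eq_smul_self {k : Type w} [Field k] {C : Type u} [Category.{v} C] [Preadditive C]
    [Linear k C] {X Y : C} {f : X ⟶ Y} (hf : f ≠ 0) {c : k} (h : f = c • f) :
    c ≠ 0 := by
  rintro rfl
  exact hf (by rw [h, zero_smul])

variable {k : Type w} [Field k] {C : Type u} [Category.{v} C] [Abelian C] [Linear k C]
  [MonoidalCategory C] [MonoidalPreadditive C] [TwoSidedDuality C] {P a b : C} {η : a ⟶ P} {ε : P ⟶ b}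

lemma nondegenerate_left (h : IsTraceTuple k η ε) (hP : Projective P) [Simple b]
    {t : RightTrace k (isRightIdeal_projective (C := C)) a b} (ht : IsAssociatedTrace k η ε t)
    (hI : isProjective C ≤ traceIdeal η ε) {U V : C} (hU : Projective U) [Projective V]
    (g : V ⟶ b ⊗ U) (hg : ∀ f : a ⊗ U ⟶ V, t.tr U hU (f ≫ g) = 0) : g = 0 := by
  let _ := TwoSidedDuality.leftDuality U
  let _ := TwoSidedDuality.rightDuality U
  by_contra hne
  set g' := (tensorRightHomEquiv V (dual U) U b).symm g with hg'
  have hg'0 : g' ≠ 0 := fun h0 => hne (by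
    rw [← (tensorRightHomEquiv V (dual U) U b).apply_symm_apply g, ← hg', h0]
    simp [tensorRightHomEquiv])
  have : Epi g' := epi_of_nonzero_to_simple hg'0
  -- Chosen so that the partial trace of `s ≫ g` is the lift of `ε` followed by the mate of `g`.
  set s := (tensorRightHomEquiv P U (dual U) V).symm (Projective.factorThru ε g') with hs
  have hsg : rightPartialTrace U (s ≫ g) = ε := by
    rw [rightPartialTrace_comp, hs, Equiv.apply_symm_apply, Projective.factorThru_comp]
  obtain ⟨τ, hτ⟩ := (hI U hU).2
  obtain ⟨c, hc, hc'⟩ := h.exists_scalar_rightPartialTrace (s ≫ g ≫ τ)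
  simp only [Category.assoc, hτ, Category.comp_id, hsg] at hc'
  refine ne_zero_of_eq_smul_self h.eps_ne_zero hc' ?_
  -- The test morphism is `η ▷ U ≫ s`; its vanishing trace makes the scalar on the `η` side zero,
  -- while on the `ε` side it fixes `ε`.
  have h1 := ht.eq_eta U hU (η ▷ U ≫ s ≫ g) τ hτ
  rw [← Category.assoc, hg, zero_smul] at h1
  simp only [Category.assoc] at h1
  rw [h1] at hc
  exact (smul_eq_zero.1 hc.symm).resolve_right h.eta_ne_zero

lemma nondegenerate_right (h : IsTraceTuple k η ε) (hP : Projective P) [Simple a]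
    {t : RightTrace k (isRightIdeal_projective (C := C)) a b} (ht : IsAssociatedTrace k η ε t)
    (hI : isProjective C ≤ traceIdeal η ε) {U V : C} (hU : Projective U)
    (f : a ⊗ U ⟶ V) (hf : ∀ g : V ⟶ b ⊗ U, t.tr U hU (f ≫ g) = 0) : f = 0 := by
  let _ := TwoSidedDuality.leftDuality U
  let _ := TwoSidedDuality.rightDuality U
  have := injective_of_projective hP
  by_contra hne
  set f' := tensorRightHomEquiv a U (dual U) V f with hf'
  have hf'0 : f' ≠ 0 := fun h0 => hne (by
    rw [← (tensorRightHomEquiv a U (dual U) V).symm_apply_apply f, ← hf', h0]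
    simp [tensorRightHomEquiv])
  have : Mono f' := mono_of_nonzero_from_simple hf'0
  set s := tensorRightHomEquiv V (dual U) U P (Injective.factorThru η f') with hs
  have hfs : rightPartialTrace U (f ≫ s) = η := by
    rw [rightPartialTrace_comp, hs, Equiv.symm_apply_apply, ← hf', Injective.comp_factorThru]
  obtain ⟨σ, hσ⟩ := (hI U hU).1
  obtain ⟨c, hc, hc'⟩ := h.exists_scalar_rightPartialTrace (σ ≫ f ≫ s)
  rw [reassoc_of% hσ, hfs] at hc
  refine ne_zero_of_eq_smul_self h.eta_ne_zero hc ?_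
  have h1 := ht.eq_eps U hU (f ≫ s ≫ ε ▷ U) σ hσ
  rw [hf, zero_smul] at h1
  simp only [Category.assoc] at hc'
  rw [h1] at hc'
  exact (smul_eq_zero.1 hc'.symm).resolve_right h.eps_ne_zero

lemma isTwistedCalabiYau (h : IsTraceTuple k η ε) (hP : Projective P) [Simple a] [Simple b]
    (hI : isProjective C ≤ traceIdeal η ε)
    {t : RightTrace k (isRightIdeal_projective (C := C)) a b} (ht : IsAssociatedTrace k η ε t) :
    IsTwistedCalabiYau k (tensorProj a) (tensorProj b) t.onProj where
  nondegenerate_left U V g hg := by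
    ext
    have : Projective V.obj := V.property
    exact nondegenerate_left h hP ht hI U.property g.hom
      fun f => hg (ObjectProperty.homMk f)
  nondegenerate_right U V f hf := by
    ext
    exact nondegenerate_right h hP ht hI U.property f.hom
      fun g => hf (ObjectProperty.homMk g)
  cyclic U V f g := t.cyclic U.obj V.obj U.property V.property f.hom g.hom

lemma isProjective_le_traceIdeal [Simple a] [Simple b] (hη : η ≠ 0) (hε : ε ≠ 0) :
    isProjective C ≤ traceIdeal η ε := by
  intro V hV
  have : Mono η := mono_of_nonzero_from_simple hη
  have : Epi ε := epi_of_nonzero_to_simple hε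
  have : Projective (b ⊗ V) := projective_tensor_left b hV
  exact ⟨splitMono_whiskerRight η hV, Projective.factorThru (𝟙 _) (ε ▷ V),
    Projective.factorThru_comp _ _⟩

/-- A twisted Calabi-Yau structure with trivial source twist gives a right Serre functor. -/
lemma IsTwistedCalabiYau.isRightSerreFunctor {D : Type u} [Category.{v} D] [Preadditive D]
    [Linear k D] (hD : LocallyFinite k D) {F G : D ⥤ D}
    {t : ∀ U : D, (F.obj U ⟶ G.obj U) →ₗ[k] k} (h : IsTwistedCalabiYau k F G t) (i : F ≅ 𝟭 D) :
    IsRightSerreFunctor k G := by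
  let p (U V : D) : (U ⟶ V) →ₗ[k] (V ⟶ G.obj U) →ₗ[k] k :=
    LinearMap.mk₂ k (fun f g => t U (i.hom.app U ≫ f ≫ g)) (by simp) (by simp) (by simp)
      (by simp)
  have hp (U V : D) : (p U V).IsPerfPair := by
    have := hD U V
    refine LinearMap.IsPerfPair.of_injective ?_ ?_
    · refine (injective_iff_map_eq_zero _).2 fun f hf => ?_
      rw [← cancel_epi (i.hom.app U), Limits.comp_zero]
      refine h.nondegenerate_right U V _ fun g => ?_
      simpa [p] using LinearMap.congr_fun hf g
    · refine (injective_iff_map_eq_zero _).2 fun g hg => ?_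
      refine h.nondegenerate_left U V g fun f => ?_
      simpa [p] using LinearMap.congr_fun hg (i.inv.app U ≫ f)
  refine ⟨fun U V => (p U V).toPerfPair, fun U V V' f x g => ?_, fun U U' V x f g => ?_⟩
  · simp [p]
  · have hx : F.map x ≫ i.hom.app U = i.hom.app U' ≫ x := i.hom.naturality x
    have := h.cyclic U' U (i.hom.app U ≫ f ≫ g) x
    simp only [Category.assoc] at this
    rw [reassoc_of% hx] at this
    simpa [p] using this.symm

/-- The functor `F_𝟙` on projective objects is isomorphic to the identity. -/
def tensorProjUnitIso : tensorProj (𝟙_ C) ≅ 𝟭 (isProjective C).FullSubcategory :=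
  NatIso.ofComponents (fun U => (isProjective C).isoMk (λ_ U.obj)) fun f => by
    ext
    exact leftUnitor_naturality f.hom

end Nondegenerate

/-! ### Existence of trace tuples -/

section Existence

variable {k : Type w} [Field k] {C : Type u} [Category.{v} C] [Abelian C] [Linear k C]

open Limits

/-- The radical kills `η`: otherwise `η ≫ n` is mono, injectivity of `P` recovers `η` as `η ≫ n ≫
h`, and `n ≫ h` is nilpotent. Dually for `ε`. Every map `a ⟶ P` extends along `η` to an endomorphism
of `P`, hence is a multiple of `η`; likewise for `ε`. -/
lemma isTraceTuple_of_simple [IsAlgClosed k] (hfin : LocallyFinite k C) {P a b : C} [Projective P]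
    [Injective P] (hP : Indecomposable P) [Simple a] [Simple b] {η : a ⟶ P} {ε : P ⟶ b}
    (hη : η ≠ 0) (hε : ε ≠ 0) : IsTraceTuple k η ε := by
  have : FiniteDimensional k (End P) := hfin P P
  have : Nontrivial (End P) := ⟨0, 1, fun h => hP.1 ((IsZero.iff_id_eq_zero P).2 h.symm)⟩
  have : Mono η := mono_of_nonzero_from_simple hη
  have : Epi ε := epi_of_nonzero_to_simple hε
  have hA : ∀ e : End P, e * e = e → e = 0 ∨ e = 1 := idempotent_of_indecomposable hP
  have hnil := isNilpotent_jacobson (End P) k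
  obtain ⟨e⟩ := nonempty_quotient_jacobson_algEquiv (End P) k hA
  have key (f : P ⟶ P) : ∃ c : k, η ≫ f = c • η ∧ f ≫ ε = c • ε := by
    obtain ⟨c, hc⟩ := exists_sub_algebraMap_mem e (End.of f)
    set n : P ⟶ P := f - c • 𝟙 P with hn
    have hf : End.of n = End.of f - algebraMap k (End P) c := by
      rw [Algebra.algebraMap_eq_smul_one]; rfl
    rw [← hf] at hc
    have h1 : η ≫ n = 0 := by
      by_contra hne
      have : Mono (η ≫ n) := mono_of_nonzero_from_simple hne
      have hmem : End.of (n ≫ Injective.factorThru η (η ≫ n)) ∈ Ring.jacobson (End P) :=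
        Ideal.mul_mem_left _ (End.of (Injective.factorThru η (η ≫ n))) hc
      have hx : η ≫ n ≫ Injective.factorThru η (η ≫ n) = (1 : k) • η := by
        rw [← Category.assoc, Injective.comp_factorThru, one_smul]
      rw [comp_eq_zero_of_isNilpotent (isNilpotent_of_mem_jacobson hnil hmem) hx, one_smul] at hx
      exact hη hx.symm
    have h2 : n ≫ ε = 0 := by
      by_contra hne
      have : Epi (n ≫ ε) := epi_of_nonzero_to_simple hne
      have hmem : End.of (Projective.factorThru ε (n ≫ ε) ≫ n) ∈ Ring.jacobson (End P) :=
        Ideal.mul_mem_right (End.of (Projective.factorThru ε (n ≫ ε))) _ hc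
      have hx : (Projective.factorThru ε (n ≫ ε) ≫ n) ≫ ε = (1 : k) • ε := by
        rw [Category.assoc, Projective.factorThru_comp, one_smul]
      rw [comp_eq_zero_of_isNilpotent' (isNilpotent_of_mem_jacobson hnil hmem) hx, one_smul] at hx
      exact hε hx.symm
    refine ⟨c, ?_, ?_⟩
    · simpa [hn, sub_eq_zero] using h1
    · simpa [hn, sub_eq_zero] using h2
  refine ⟨hη, hε, ⟨e⟩, hnil, fun g => ?_, fun g => ?_⟩
  · obtain ⟨c, hc, -⟩ := key (Injective.factorThru g η)
    rw [Injective.comp_factorThru] at hc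
    exact ⟨c, hc, fun y hy => smul_left_injective k hη (hy.symm.trans hc)⟩
  · obtain ⟨c, -, hc⟩ := key (Projective.factorThru g ε)
    rw [Projective.factorThru_comp] at hc
    exact ⟨c, hc, fun y hy => smul_left_injective k hε (hy.symm.trans hc)⟩

/-- A nonzero morphism to a projective object can be chosen with indecomposable target. -/
lemma exists_indecomposable_projective (hfin : LocallyFinite k C) {a Q : C} (hQ : Projective Q)
    (f : a ⟶ Q) (hf : f ≠ 0) :
    ∃ (P : C) (η : a ⟶ P), Projective P ∧ Indecomposable P ∧ η ≠ 0 := by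
  let S : Set ℕ := {n | ∃ (P : C) (η : a ⟶ P), Projective P ∧ η ≠ 0 ∧
    Module.finrank k (P ⟶ P) = n}
  obtain ⟨n, ⟨P, η, hP, hη, hn⟩, hmin⟩ :=
    WellFounded.has_min (α := ℕ) wellFounded_lt S ⟨_, Q, f, hQ, hf, rfl⟩
  -- If `η` has a nonzero component in the summand `Y`, then `End Y` embeds in `End P` and misses
  -- the projection onto `Z` unless `Z = 0`.
  have key {Y Z : C} (i : Y ⟶ P) (r : P ⟶ Y) (j : Z ⟶ P) (s : P ⟶ Z) (hir : i ≫ r = 𝟙 Y)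
      (hjs : j ≫ s = 𝟙 Z) (his : i ≫ s = 0) (hne : η ≫ r ≠ 0) : IsZero Z := by
    by_contra hZ
    have hY : Projective Y :=
      have : IsSplitEpi r := ⟨⟨⟨i, hir⟩⟩⟩
      Retract.projective (Y := P) ⟨i, r, hir⟩
    refine hmin _ ⟨Y, η ≫ r, hY, hne, rfl⟩ ?_
    rw [← hn]
    have := hfin P P
    have := hfin Y Y
    let φ : (Y ⟶ Y) →ₗ[k] (P ⟶ P) := Linear.leftComp k P r ∘ₗ Linear.rightComp k Y i
    have hφ (x : Y ⟶ Y) : φ x = r ≫ x ≫ i := rfl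
    have hinj : Function.Injective φ := fun x y hxy => by
      have := congrArg (fun z => i ≫ z ≫ r) ((hφ x).symm.trans (hxy.trans (hφ y)))
      simpa [hir, reassoc_of% hir] using this
    rw [← LinearMap.finrank_range_of_inj hinj]
    refine Submodule.finrank_lt fun htop => hZ ((IsZero.iff_id_eq_zero Z).2 ?_)
    obtain ⟨x, hx⟩ : s ≫ j ∈ LinearMap.range φ := htop ▸ Submodule.mem_top
    have := congrArg (fun z => j ≫ z ≫ s) hx
    simpa [hφ, his, hjs, reassoc_of% hjs] using this.symm
  refine ⟨P, η, hP, ⟨fun h => hη (h.eq_of_tgt _ _), fun Y Z e => ?_⟩, hη⟩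
  by_cases hne : η ≫ e.hom ≫ biprod.fst = 0
  · left
    refine key (biprod.inr ≫ e.inv) (e.hom ≫ biprod.snd) (biprod.inl ≫ e.inv)
      (e.hom ≫ biprod.fst) (by simp) (by simp) (by simp) fun h => hη ?_
    rw [← cancel_mono e.hom, zero_comp]
    ext
    · simpa using hne
    · simpa using h
  · exact Or.inr (key (biprod.inl ≫ e.inv) (e.hom ≫ biprod.fst) (biprod.inr ≫ e.inv)
      (e.hom ≫ biprod.snd) (by simp) (by simp) (by simp) hne)

/-- A full subcategory of a locally finite category is locally finite. -/
lemma locallyFinite_fullSubcategory (hfin : LocallyFinite k C) (I : ObjectProperty C) :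
    LocallyFinite k I.FullSubcategory := fun X Y =>
  have := hfin X.obj Y.obj
  FiniteDimensional.of_injective (InducedCategory.homLinearEquiv (R := k)).toLinearMap
    (InducedCategory.homLinearEquiv (R := k) (X := X) (Y := Y)).injective

lemma isZero_of_coevL_eq_zero [MonoidalCategory C] [MonoidalPreadditive C] [TwoSidedDuality C]
    {V : C} (h : coevL V = 0) : IsZero V := by
  rw [IsZero.iff_id_eq_zero]
  calc
    𝟙 V = (λ_ V).inv ≫ (coevL V ▷ V ⊗≫ V ◁ evL V) ≫ (ρ_ V).hom := by
      rw [coevL_evL]; simp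
    _ = 0 := by rw [h]; simp [monoidalComp]

end Existence

end PivotalTrace

theorem theoremT {k : Type w} [Field k] [IsAlgClosed k]
    {C : Type u} [Category.{v} C] [Abelian C] [Linear k C]
    [MonoidalCategory C] [MonoidalPreadditive C] [MonoidalLinear k C]
    [PivotalTrace.PivotalCategory C]
    (hunit : PivotalTrace.AbsolutelyIrreducible k (𝟙_ C))
    (hfin : PivotalTrace.LocallyFinite k C)
    (hproj : PivotalTrace.HasProjectiveCovers C) :
    (∀ P : C, Projective P → Indecomposable P →
      (∃ (a b : C) (η : a ⟶ P) (ε : P ⟶ b),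
        Simple a ∧ Simple b ∧ PivotalTrace.IsTraceTuple k η ε) ∧
      (∀ (a b : C) (η : a ⟶ P) (ε : P ⟶ b),
        Simple a → Simple b → PivotalTrace.IsTraceTuple k η ε →
          isProjective C ≤ PivotalTrace.traceIdeal η ε ∧
          (∃! t : PivotalTrace.RightTrace k (PivotalTrace.isRightIdeal_projective (C := C)) a b,
            PivotalTrace.IsAssociatedTrace k η ε t) ∧
          (∀ t : PivotalTrace.RightTrace k (PivotalTrace.isRightIdeal_projective (C := C)) a b,
            PivotalTrace.IsAssociatedTrace k η ε t →
              PivotalTrace.IsTwistedCalabiYau k (PivotalTrace.tensorProj a)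
                (PivotalTrace.tensorProj b) t.onProj))) ∧
    (∃ (P b : C) (η : 𝟙_ C ⟶ P) (ε : P ⟶ b),
      Projective P ∧ Indecomposable P ∧ Simple b ∧ PivotalTrace.IsTraceTuple k η ε ∧
      PivotalTrace.IsRightSerreFunctor k (PivotalTrace.tensorProj b)) := by
  obtain ⟨Q, q, hq⟩ := hproj (𝟙_ C)
  have hQ : Projective Q := hq.projective
  have := hq.epi
  have hdet (P : C) : PivotalTrace.SubquotientsDetectedBy (Q ⊗ P) P :=
    fun _ _ i p _ _ hY => PivotalTrace.subquotientsDetectedBy_tensor hQ q P i p hY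
  have hQP (P : C) : Projective (Q ⊗ P) := PivotalTrace.projective_tensor_right hQ P
  refine ⟨fun P hP hPi => ⟨?_, fun a b η ε ha hb h => ?_⟩, ?_⟩
  · have := PivotalTrace.injective_of_projective hP
    have := hQP P
    obtain ⟨a, η, ha, hη⟩ := PivotalTrace.exists_simple_subobject hfin (hdet P) hPi.1
    obtain ⟨b, ε, hb, hε⟩ := PivotalTrace.exists_simple_quotient hfin (hdet P) hPi.1
    refine ⟨a, b, η, ε, ha, hb, PivotalTrace.isTraceTuple_of_simple hfin hPi ?_ ?_⟩
    · rintro rfl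
      exact Simple.not_isZero a (Limits.IsZero.of_mono_zero a P)
    · rintro rfl
      exact Simple.not_isZero b (Limits.IsZero.of_epi_zero P b)
  · have hI := PivotalTrace.isProjective_le_traceIdeal (C := C) h.eta_ne_zero h.eps_ne_zero
    exact ⟨hI, h.existsUnique_rightTrace hI, fun t ht => PivotalTrace.isTwistedCalabiYau h hP hI ht⟩
  · have hsimple := PivotalTrace.simple_unit hunit
    have hcoev : PivotalTrace.coevL Q ≠ 0 := fun h => by
      have hQ0 : Limits.IsZero Q := PivotalTrace.isZero_of_coevL_eq_zero h
      exact Simple.not_isZero (𝟙_ C) (Limits.IsZero.of_epi q hQ0)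
    obtain ⟨P, η, hP, hPi, hη⟩ := PivotalTrace.exists_indecomposable_projective (k := k) hfin
      (PivotalTrace.projective_tensor_right hQ (PivotalTrace.dual Q)) _ hcoev
    have := PivotalTrace.injective_of_projective hP
    have := hQP P
    obtain ⟨b, ε, hb, hε⟩ := PivotalTrace.exists_simple_quotient hfin (hdet P) hPi.1
    have hε0 : ε ≠ 0 := by
      rintro rfl
      exact Simple.not_isZero b (Limits.IsZero.of_epi_zero P b)
    have h := PivotalTrace.isTraceTuple_of_simple hfin hPi hη hε0
    have hI := PivotalTrace.isProjective_le_traceIdeal (C := C) hη hε0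
    refine ⟨P, b, η, ε, hP, hPi, hb, h, ?_⟩
    exact (PivotalTrace.isTwistedCalabiYau h hP hI
      (h.isAssociatedTrace_rightTrace hI)).isRightSerreFunctor
        (PivotalTrace.locallyFinite_fullSubcategory hfin _) PivotalTrace.tensorProjUnitIso
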